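/- **Setting.** Let $V=[n]$. A *locally fixable labeling* (LFL) on $V$ is a tuple $\mathcal L=(\Sigma,\Gamma,\mathcal E,\mathcal P,\mathrm{prep},\mathrm{fix})$ as follows. $\Sigma$ is a set of input labels, and $\Gamma\subseteq X^n$ is a set of output labels $L_v=(L_{v1},\dots,L_{vn})$; $L_{vv}$ is the node excerpt of $v$, and $L_{vu}$, $u\ne v$, is its edge excerpt for $u$. (The objects below may also depend on the input labels of the nodes that occur in them.) * $\mathcal E$ determines for each unordered pair $\{v,u\}$ which tuples $(L_{vv},L_{vu},L_{uv},L_{uu})\in X^4$ are *$\{v,u\}$-correct*; every correct tuple has $L_{vu}=L_{uv}$ (*reciprocity*). * $\mathcal P$ determines, for each node $v$ and each possible set $N_v\subseteq V\setminus\{v\}$ of neighbors, which labels in $\Gamma$ are *$N_v$-prepared* for $v$. * $\mathrm{prep}$ is a *preparing function*: if $L_v$ is $N_v^{old}$-prepared, then $L_v'=\mathrm{prep}(v,N_v^{old},N_v^{new},L_v)$ is $N_v^{new}$-prepared and $L'_{vu}=L_{vu}$ for all $u\neq v$ with $u\notin N_v^{old}\oplus N_v^{new}$; moreover, if $\{u,v\}$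 is a new edge (i.e. $u\in N_v^{new}\setminus N_v^{old}$ and $v\in N_u^{new}\setminus N_u^{old}$) and $L_v,L_u$ are $N_v^{old}$- and $N_u^{old}$-prepared, then the labels $L_v',L_u'$ that $\mathrm{prep}$ yields for $v$ and $u$ satisfy $L'_{vu}=L'_{uv}$. * $\mathrm{fix}$ is a *fixing function*: it takes $v$, a set $N_v=\{u_1,\dots,u_d\}$ of neighbors, $L_v\in\Gamma$ and excerpts $L_{u_1u_1},\dots,L_{u_du_d}$, and returns $(\ell,\beta_1,\dots,\beta_d)\in\Gamma\times X^d$. For every graph $G$ on $V$ in which $v$ has neighborhood $N_v$ and every labeling $L:V\to\Gamma$ such that $L_v$ and all $L_{u_i}$ are prepared for their neighborhoods in $G$ and $L_{vu_i}=L_{u_iv}$ for all $i$, let $L'$ be the labeling with $L'_v=\ell$, $L'_{u_iu_i}=\beta_i$, $L'_{u_iv}=\ell_{u_i}$, and all other entries as in $L$. Then $L'_v$ is $N_v$-prepared, and for every $i$: the tuple of $L'$ for $\{v,u_i\}$ is correct; $L'_{u_i}$ is prepared for the neighborhood of $u_i$ in $G$; and for every neighbor $w\ne v$ of $u_i$ in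 $G$, if the tuple of $L$ for $\{u_i,w\}$ is correct, then so is the tuple of $L'$. Given a graph and a labeling, the star of $v$ is *consistent* if $L_v$ is $N_v$-prepared and the tuple of $\{v,u\}$ is correct for every neighbor $u$ of $v$; the labeling is *$\mathcal L$-legal* if all stars are consistent. $\mathcal L$ is *bounded* (with constant $c$) if all inputs and all excerpts can be encoded with at most $c\log n$ bits. The network is synchronous with graph $G_i$ on $V$ in round $i$; $G_0,G_1,\dots$ is arbitrary, so any number of edges may be inserted and deleted concurrently in each round. Each node starts with its id, its input, its incident edges and its initial output label, where the initial labeling is $\mathcal L$-legal for $G_0$. In each round, a node learns which of its edges have changed, sends a message to each of its current neighbors, receives messages and updates its state and its label by an arbitrary deterministic computation. Let $\mathrm{changes}(i)$ be the number of edge insertions and deletions until round $i$, and $\mathrm{incorrect}(i)$ the number of rounds until round $i$ in which some star is inconsistent (at the beginning of the round, when the topology has already changed, or at its end). The algorithm is a *fixing algorithm* if, from any round on, the star of each node $v$ is eventually consistent unless a topology change touches an edge of $v$ or of a neighbor of $v$. It has *amortized round complexity $K$* if $\mathrm{incorrect}(i)\le K\cdot\mathrm{changes}(i)$ for every $i$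 in every execution. **Theorem.** There is a constant $K$, and for every $c$ there is a constant $C$, such that for every $n$ and every bounded (with constant $c$) LFL $\mathcal L$ on $[n]$, there is a deterministic dynamic distributed fixing algorithm for $\mathcal L$ which handles arbitrary concurrent edge insertions and deletions in at most $K$ amortized rounds, with messages of at most $C\log n$ bits. (Here $\log n$ stands for $\lceil\log_2 n\rceil$.) -/

import Mathlib

open scoped symmDiff

/-- The combinatorial part `(Σ, Γ, 𝓔, 𝓟)` of a locally fixable labeling on the node set
`V = Fin n`, with input labels in `In` (the set `Σ`) and excerpts in `X`.  An output label of a node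
`v` is a vector `L : Fin n → X`; the entry `L v` is its node excerpt, and `L u`, for `u ≠ v`, is its
edge excerpt for `u`. -/
structure LabelingScheme (n : ℕ) (In X : Type) where
  /-- The set `Γ ⊆ Xⁿ` of output labels. -/
  labels : Set (Fin n → X)
  /-- The set `𝓔`: `edgeCorrect v u sv su a e f b` says that `(L_vv, L_vu, L_uv, L_uu) = (a, e, f, b)`
  is a `{v, u}`-correct tuple, where `sv` and `su` are the input labels of `v` and `u`. -/
  edgeCorrect : Fin n → Fin n → In → In → X → X → X → X → Prop
  /-- The pairs `{v, u}` are unordered. -/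
  edgeCorrect_symm : ∀ v u sv su a e f b,
    edgeCorrect v u sv su a e f b → edgeCorrect u v su sv b f e a
  /-- The reciprocity property. -/
  edgeCorrect_reciprocal : ∀ v u sv su a e f b, edgeCorrect v u sv su a e f b → e = f
  /-- The set `𝓟`: `prepared v N s L` says that `L` is an `N`-prepared label of `v`, where `N` is the
  set of neighbors of `v` and `s` is the input label of `v`. -/
  prepared : Fin n → Set (Fin n) → In → (Fin n → X) → Prop
  prepared_mem : ∀ v N s L, prepared v N s L → L ∈ labels

namespace LabelingScheme

variable {n : ℕ} {In X : Type} (S : LabelingScheme n In X)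

/-- Given input labels and output labels for all nodes, the edge excerpts and the node excerpts of
`v` and `u` form a `{v, u}`-correct tuple. -/
def PairCorrect (inp : Fin n → In) (L : Fin n → Fin n → X) (v u : Fin n) : Prop :=
  S.edgeCorrect v u (inp v) (inp u) (L v v) (L v u) (L u v) (L u u)

/-- The star of `v` is consistent in the graph `G`: the label of `v` together with the excerpts of
its neighbors is an `N_v`-consistent view. -/
def StarConsistent (G : SimpleGraph (Fin n)) (inp : Fin n → In) (L : Fin n → Fin n → X)
    (v : Fin n) : Prop :=
  S.prepared v (G.neighborSet v) (inp v) (L v) ∧ ∀ u ∈ G.neighborSet v, S.PairCorrect inp L v u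

/-- A legal labeling: all stars are consistent. -/
def Legal (G : SimpleGraph (Fin n)) (inp : Fin n → In) (L : Fin n → Fin n → X) : Prop :=
  ∀ v, S.StarConsistent G inp L v

/-- Preparing functions.  A preparing function lets a node `v`, whose neighborhood has changed from
`Nold` to `Nnew`, change its own label without any communication.  -/
structure IsPreparing
    (prep : Fin n → Set (Fin n) → Set (Fin n) → In → S.labels → S.labels) : Prop where
  prepared : ∀ (v : Fin n) (Nold Nnew : Set (Fin n)) (s : In) (L : S.labels),
    v ∉ Nold → v ∉ Nnew → S.prepared v Nold s L.1 →
      S.prepared v Nnew s (prep v Nold Nnew s L).1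
  /-- Edge excerpts of pairs that are not affected by the change stay the same. -/
  unchanged : ∀ (v : Fin n) (Nold Nnew : Set (Fin n)) (s : In) (L : S.labels),
    v ∉ Nold → v ∉ Nnew → S.prepared v Nold s L.1 →
      ∀ u, u ≠ v → u ∉ Nold ∆ Nnew → (prep v Nold Nnew s L).1 u = L.1 u
  /-- The two endpoints of a new edge `{v, u}` choose the excerpts of this edge in a way that
  satisfies the reciprocity property. -/
  reciprocal : ∀ (v u : Fin n) (Nv Nv' Nu Nu' : Set (Fin n)) (sv su : In) (Lv Lu : S.labels),
    v ∉ Nv → v ∉ Nv' → u ∉ Nu → u ∉ Nu' →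
    S.prepared v Nv sv Lv.1 → S.prepared u Nu su Lu.1 →
    u ∉ Nv → v ∉ Nu → u ∈ Nv' → v ∈ Nu' →
      (prep v Nv Nv' sv Lv).1 u = (prep u Nu Nu' su Lu).1 v

open Classical in
/-- The labels of all nodes after the node `v`, with set of neighbors `N`, has been fixed: `v`
receives the new label `ℓ`; the label of a neighbor `u` receives the new node excerpt `β u` and the
new edge excerpt `ℓ u` for the pair `{u, v}`; nothing else changes. -/
noncomputable def afterFix (L : Fin n → Fin n → X) (v : Fin n) (N : Set (Fin n))
    (ℓ : Fin n → X) (β : N → X) : Fin n → Fin n → X := fun w =>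
  if w = v then ℓ
  else if h : w ∈ N then Function.update (Function.update (L w) w (β ⟨w, h⟩)) v (ℓ w)
  else L w

/-- Fixing functions.  A fixing function is given the node `v`, its set `N` of neighbors, its
input label, the input labels of its neighbors, its label and the node excerpts of its
neighbors, and returns a new label for `v` and a new node excerpt for each neighbor. -/
def IsFixing
    (fix : Fin n → (N : Set (Fin n)) → In → (N → In) → S.labels → (N → X) →
      S.labels × (N → X)) : Prop :=
  ∀ (G : SimpleGraph (Fin n)) (inp : Fin n → In) (L : Fin n → S.labels) (v : Fin n),
    S.prepared v (G.neighborSet v) (inp v) (L v).1 →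
    (∀ u ∈ G.neighborSet v, S.prepared u (G.neighborSet u) (inp u) (L u).1) →
    (∀ u ∈ G.neighborSet v, (L v).1 u = (L u).1 v) →
    let out := fix v (G.neighborSet v) (inp v) (fun u => inp u) (L v) (fun u => (L u).1 u)
    let L' := afterFix (fun w => (L w).1) v (G.neighborSet v) out.1.1 out.2
    -- preparedness
    S.prepared v (G.neighborSet v) (inp v) (L' v) ∧
    ∀ u ∈ G.neighborSet v,
      -- edge-correctness
      S.PairCorrect inp L' v u ∧
      -- preparedness for the neighbor
      S.prepared u (G.neighborSet u) (inp u) (L' u) ∧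
      -- edge-correctness for the neighbor
      ∀ w ∈ G.neighborSet u, w ≠ v →
        S.PairCorrect inp (fun w => (L w).1) u w → S.PairCorrect inp L' u w

end LabelingScheme

/-- A locally fixable labeling (LFL) `(Σ, Γ, 𝓔, 𝓟, prep, fix)` on the node set `Fin n`. -/
structure LFL (n : ℕ) (In X : Type) extends LabelingScheme n In X where
  prep : Fin n → Set (Fin n) → Set (Fin n) → In → labels → labels
  fix : Fin n → (N : Set (Fin n)) → In → (N → In) → labels → (N → X) → labels × (N → X)
  prep_isPreparing : toLabelingScheme.IsPreparing prep
  fix_isFixing : toLabelingScheme.IsFixing fix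

/-- The elements of `α` can be encoded by bit strings of length at most `b`. -/
def EncodableInBits (α : Type) (b : ℕ) : Prop :=
  ∃ enc : α → List Bool, Function.Injective enc ∧ ∀ a, (enc a).length ≤ b

/-- A deterministic distributed algorithm on the node set `Fin n` in the synchronous dynamic
network model, where the nodes have input labels in `In` and maintain output labels in `Out`.
A node starts with its id, its initial set of neighbors, its input label and its initial output
label. In each round it first learns its current set of neighbors (so, by comparing with the previous
one, which changes of its edges have occurred), sends a bit string to each neighbor, and
updates its state based on the bit strings that it receives. Local computation is unrestricted. -/
structure DynAlgorithm (n : ℕ) (In Out : Type) where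
  State : Type
  init : Fin n → Set (Fin n) → In → Out → State
  /-- `send s N u` is the message to the neighbor `u` of a node in state `s` with neighbors `N`. -/
  send : State → Set (Fin n) → Fin n → List Bool
  /-- `step s N inbox` is the state after the round; `inbox u = none` if `u` is no neighbor. -/
  step : State → Set (Fin n) → (Fin n → Option (List Bool)) → State
  /-- The label stored by a node. -/
  output : State → Out
  output_init : ∀ v N s L, output (init v N s L) = L

namespace DynAlgorithm

variable {n : ℕ} {In Out : Type} (A : DynAlgorithm n In Out)

/-- Every message has at most `b` bits. -/
def HasBandwidth (b : ℕ) : Prop := ∀ s N u, (A.send s N u).length ≤ b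

open Classical in
/-- `A.state G inp L₀ i v` is the state of `v` at the beginning of round `i`, where `G i` is the
graph in round `i`. -/
noncomputable def state (G : ℕ → SimpleGraph (Fin n)) (inp : Fin n → In) (L₀ : Fin n → Out) :
    ℕ → Fin n → A.State
  | 0, v => A.init v ((G 0).neighborSet v) (inp v) (L₀ v)
  | i + 1, v =>
      A.step (state G inp L₀ i v) ((G i).neighborSet v) fun u =>
        if (G i).Adj v u then some (A.send (state G inp L₀ i u) ((G i).neighborSet u) v) else none

/-- The output label of `v` at the beginning of round `i`, i.e. at the end of round `i - 1`. -/
noncomputable def labeling (G : ℕ → SimpleGraph (Fin n)) (inp : Fin n → In) (L₀ : Fin n → Out)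
    (i : ℕ) (v : Fin n) : Out :=
  A.output (A.state G inp L₀ i v)

end DynAlgorithm

/-- The number of edge insertions and deletions until round `i`: those that lead from `G 0` to
`G 1`, from `G 1` to `G 2`, …, and from `G (i - 1)` to `G i`. -/
noncomputable def changes {n : ℕ} (G : ℕ → SimpleGraph (Fin n)) (i : ℕ) : ℕ :=
  ∑ j ∈ Finset.range i, ((G j).edgeSet ∆ (G (j + 1)).edgeSet).ncard

/-- Between rounds `j` and `j + 1`, an edge of a node in the closed neighborhood of `v` is inserted
or deleted. -/
def Touched {n : ℕ} (G : ℕ → SimpleGraph (Fin n)) (v : Fin n) (j : ℕ) : Prop :=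
  ∃ w, (w = v ∨ (G j).Adj v w) ∧ (G j).neighborSet w ≠ (G (j + 1)).neighborSet w

namespace LFL

variable {n : ℕ} {In X : Type}

/-- All inputs and all excerpts have at most `c log n` bits. -/
def Bounded (_ : LFL n In X) (c : ℕ) : Prop :=
  EncodableInBits In (c * Nat.clog 2 n) ∧ EncodableInBits X (c * Nat.clog 2 n)

variable (𝓛 : LFL n In X)

/-- The underlying vectors of the output labels of `A` at the beginning of round `i`. -/
noncomputable def run (A : DynAlgorithm n In 𝓛.labels) (G : ℕ → SimpleGraph (Fin n))
    (inp : Fin n → In) (L₀ : Fin n → 𝓛.labels) (i : ℕ) : Fin n → Fin n → X :=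
  fun v => (A.labeling G inp L₀ i v).1

/-- The number of rounds `0, …, i` in which there is an inconsistent star, at the beginning
of the round (when the graph has already changed) or at its end. -/
noncomputable def incorrect (A : DynAlgorithm n In 𝓛.labels) (G : ℕ → SimpleGraph (Fin n))
    (inp : Fin n → In) (L₀ : Fin n → 𝓛.labels) (i : ℕ) : ℕ :=
  {j : ℕ | j ≤ i ∧ ¬ (𝓛.Legal (G j) inp (𝓛.run A G inp L₀ j) ∧
    𝓛.Legal (G j) inp (𝓛.run A G inp L₀ (j + 1)))}.ncard

/-- `A` is a dynamic distributed fixing algorithm for `𝓛` under edge insertions and deletions: for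
all inputs, all sequences of graphs and all legal initial labelings, the fixing process of each star
ends, at any time, with a consistent star or with a topology change that touches the star. -/
def IsFixingAlgorithm (A : DynAlgorithm n In 𝓛.labels) : Prop :=
  ∀ (G : ℕ → SimpleGraph (Fin n)) (inp : Fin n → In) (L₀ : Fin n → 𝓛.labels),
    𝓛.Legal (G 0) inp (fun v => (L₀ v).1) →
    ∀ (v : Fin n) (i : ℕ), ∃ j ≥ i,
      𝓛.StarConsistent (G j) inp (𝓛.run A G inp L₀ j) v ∨ Touched G v j

/-- `A` has amortized round complexity `K` under edge insertions and deletions. The inequality for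
`changes G i = 0` says that no round is charged before the first change. -/
def HasAmortizedComplexity (A : DynAlgorithm n In 𝓛.labels) (K : ℕ) : Prop :=
  ∀ (G : ℕ → SimpleGraph (Fin n)) (inp : Fin n → In) (L₀ : Fin n → 𝓛.labels),
    𝓛.Legal (G 0) inp (fun v => (L₀ v).1) →
    ∀ i, 𝓛.incorrect A G inp L₀ i ≤ K * changes G i

end LFL

/-! Every node carries a dirty flag, set when its neighborhood changes and cleared when it fixes its
star. The invariant (`Valid`, proved along executions in `IsExecution.valid`) is that all labels are
prepared, all edges are reciprocal, and every edge between two clean nodes is correct. A topology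
change is absorbed by local preparation at the price of making the affected nodes dirty
(`prepare_valid`), and fixing a star makes its center clean (`fixAt_valid`).

Time is divided into epochs of three rounds: dirty nodes announce themselves; every node names the
first dirty node in its closed neighborhood; a node named by its whole closed neighborhood computes
a fix, which it distributes in the third round if its edges are still the same. A node names only
one center, so concurrent fixes concern disjoint closed neighborhoods and act like successive ones
(`concurrent_fix_valid`).

In an epoch without changes the globally first dirty node becomes clean (`not_dirty_of_min`). With
three times the number of dirty nodes as potential, this gives the amortized bound (`ncard_bad_le`).
Changes elsewhere could keep producing dirty nodes of higher priority; therefore the priorities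
rotate, so that each node is globally first in every `n`-th epoch, which yields the fixing property
(`eventually_starConsistent`). -/

namespace LabelingScheme

variable {n : ℕ} {In X : Type}

/-! ### Validity relative to a set of dirty nodes. -/

theorem afterFix_self (L : Fin n → Fin n → X) (v : Fin n) (N : Set (Fin n)) (l : Fin n → X)
    (β : N → X) : afterFix L v N l β v = l := by
  simp [afterFix]

theorem afterFix_of_mem (L : Fin n → Fin n → X) {v w : Fin n} {N : Set (Fin n)} (l : Fin n → X)
    (β : N → X) (hwv : w ≠ v) (hw : w ∈ N) :
    afterFix L v N l β w =
      Function.update (Function.update (L w) w (β ⟨w, hw⟩)) v (l w) := by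
  simp [afterFix, hwv, hw]

theorem afterFix_of_notMem (L : Fin n → Fin n → X) {v w : Fin n} {N : Set (Fin n)}
    (l : Fin n → X) (β : N → X) (hwv : w ≠ v) (hw : w ∉ N) : afterFix L v N l β w = L w := by
  simp [afterFix, hwv, hw]

theorem PairCorrect.symm {S : LabelingScheme n In X} {inp : Fin n → In} {L : Fin n → Fin n → X}
    {v u : Fin n} (h : S.PairCorrect inp L v u) : S.PairCorrect inp L u v :=
  S.edgeCorrect_symm _ _ _ _ _ _ _ _ h

theorem PairCorrect.reciprocal {S : LabelingScheme n In X} {inp : Fin n → In}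
    {L : Fin n → Fin n → X} {v u : Fin n} (h : S.PairCorrect inp L v u) : L v u = L u v :=
  S.edgeCorrect_reciprocal _ _ _ _ _ _ _ _ h

theorem PairCorrect.congr {S : LabelingScheme n In X} {inp : Fin n → In}
    {L L' : Fin n → Fin n → X} {v u : Fin n} (h : S.PairCorrect inp L v u) (hv : L' v = L v)
    (hu : L' u = L u) : S.PairCorrect inp L' v u := by
  unfold PairCorrect at *
  rwa [hv, hu]

/-- All labels are prepared, all edges are reciprocal, and every edge whose endpoints both lie
outside `D` is correct. -/
structure Valid (S : LabelingScheme n In X) (G : SimpleGraph (Fin n)) (inp : Fin n → In)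
    (L : Fin n → S.labels) (D : Set (Fin n)) : Prop where
  prepared : ∀ v, S.prepared v (G.neighborSet v) (inp v) (L v).1
  reciprocal : ∀ v u, G.Adj v u → (L v).1 u = (L u).1 v
  correct : ∀ v u, G.Adj v u → v ∉ D → u ∉ D → S.PairCorrect inp (fun w => (L w).1) v u

theorem Valid.of_legal {S : LabelingScheme n In X} {G : SimpleGraph (Fin n)} {inp : Fin n → In}
    {L : Fin n → S.labels} (h : S.Legal G inp fun v => (L v).1) : S.Valid G inp L ∅ where
  prepared v := (h v).1
  reciprocal v u hvu := ((h v).2 u hvu).reciprocal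
  correct v u hvu _ _ := (h v).2 u hvu

theorem Valid.starConsistent {S : LabelingScheme n In X} {G : SimpleGraph (Fin n)}
    {inp : Fin n → In} {L : Fin n → S.labels} {D : Set (Fin n)} (h : S.Valid G inp L D) {v : Fin n}
    (hv : v ∉ D) (hN : ∀ u, G.Adj v u → u ∉ D) :
    S.StarConsistent G inp (fun w => (L w).1) v :=
  ⟨h.prepared v, fun u hu => h.correct v u hu hv (hN u hu)⟩

theorem Valid.legal {S : LabelingScheme n In X} {G : SimpleGraph (Fin n)}
    {inp : Fin n → In} {L : Fin n → S.labels} (h : S.Valid G inp L ∅) :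
    S.Legal G inp (fun w => (L w).1) :=
  fun _ => h.starConsistent (by simp) (by simp)

end LabelingScheme

/-! ### Fixing one star, and fixing disjoint stars concurrently. -/

namespace LFL

open LabelingScheme

variable {n : ℕ} {In X : Type} (𝓛 : LFL n In X)

/-- The output of the fixing function at `v`. -/
def fixOutput (G : SimpleGraph (Fin n)) (inp : Fin n → In) (L : Fin n → 𝓛.labels) (v : Fin n) :
    𝓛.labels × (G.neighborSet v → X) :=
  𝓛.fix v (G.neighborSet v) (inp v) (fun u => inp u) (L v) (fun u => (L u).1 u)

/-- The labels after the star of `v` has been fixed. -/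
noncomputable def fixAt (G : SimpleGraph (Fin n)) (inp : Fin n → In) (L : Fin n → 𝓛.labels)
    (v : Fin n) : Fin n → Fin n → X :=
  afterFix (fun w => (L w).1) v (G.neighborSet v) (𝓛.fixOutput G inp L v).1.1
    (𝓛.fixOutput G inp L v).2

variable {𝓛} {G : SimpleGraph (Fin n)} {inp : Fin n → In} {L : Fin n → 𝓛.labels}
  {D : Set (Fin n)}

theorem fixAt_of_far {v w : Fin n} (hwv : w ≠ v) (hw : ¬ G.Adj v w) :
    𝓛.fixAt G inp L v w = (L w).1 :=
  afterFix_of_notMem _ _ _ hwv hw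

theorem fixAt_self (v : Fin n) : 𝓛.fixAt G inp L v v = (𝓛.fixOutput G inp L v).1.1 :=
  afterFix_self _ _ _ _ _

theorem fixAt_of_adj {v w : Fin n} (hw : G.Adj v w) :
    𝓛.fixAt G inp L v w =
      Function.update (Function.update (L w).1 w ((𝓛.fixOutput G inp L v).2 ⟨w, hw⟩)) v
        ((𝓛.fixOutput G inp L v).1.1 w) :=
  afterFix_of_mem _ _ _ hw.ne' hw

/-- A fix reads only labels in the closed neighborhood of its center. This locality is what makes
fixes of disjoint stars commute. -/
theorem fixAt_congr {L' : Fin n → 𝓛.labels} {v w : Fin n}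
    (h : ∀ x, x = v ∨ G.Adj v x → L' x = L x) (hw : w = v ∨ G.Adj v w) :
    𝓛.fixAt G inp L' v w = 𝓛.fixAt G inp L v w := by
  have hout : 𝓛.fixOutput G inp L' v = 𝓛.fixOutput G inp L v := by
    unfold fixOutput
    rw [h v (Or.inl rfl)]
    congr 1
    funext u
    rw [h u (Or.inr u.2)]
  rcases hw with rfl | hw
  · rw [fixAt_self, fixAt_self, hout]
  · rw [fixAt_of_adj hw, fixAt_of_adj hw, hout, h w (Or.inr hw)]

theorem fixAt_prepared (h : 𝓛.Valid G inp L D) (v w : Fin n) :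
    𝓛.prepared w (G.neighborSet w) (inp w) (𝓛.fixAt G inp L v w) := by
  have hf := 𝓛.fix_isFixing G inp L v (h.prepared v) (fun u _ => h.prepared u)
    (fun u hu => h.reciprocal v u hu)
  by_cases hwv : w = v
  · subst hwv; exact hf.1
  by_cases hw : G.Adj v w
  · exact (hf.2 w hw).2.1
  · rw [fixAt_of_far hwv hw]; exact h.prepared w

/-- Edges at `v` become correct by the fixing property, hence reciprocal. On other edges the edge
excerpts do not move, and the fixing property preserves correctness although node excerpts of
neighbors of `v` may change. -/
theorem fixAt_valid (h : 𝓛.Valid G inp L D) {v : Fin n} {L' : Fin n → 𝓛.labels}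
    (hL' : ∀ w, (L' w).1 = 𝓛.fixAt G inp L v w) : 𝓛.Valid G inp L' (D \ {v}) := by
  have hf := 𝓛.fix_isFixing G inp L v (h.prepared v) (fun u _ => h.prepared u)
    (fun u hu => h.reciprocal v u hu)
  have hL'' : (fun w => (L' w).1) = 𝓛.fixAt G inp L v := funext hL'
  have hpair : ∀ u, G.Adj v u → 𝓛.PairCorrect inp (fun w => (L' w).1) v u := by
    intro u hu
    rw [hL'']
    exact (hf.2 u hu).1
  refine ⟨fun w => ?_, fun a b hab => ?_, fun a b hab ha hb => ?_⟩
  · rw [hL' w]; exact fixAt_prepared h v w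
  · by_cases hav : a = v
    · subst hav; exact (hpair b hab).reciprocal
    by_cases hbv : b = v
    · subst hbv; exact (hpair a hab.symm).reciprocal.symm
    have key : ∀ a b, G.Adj a b → a ≠ v → b ≠ v → (L' a).1 b = (L a).1 b := by
      intro a b hab hav hbv
      rw [hL' a]
      by_cases haN : G.Adj v a
      · rw [fixAt_of_adj haN, Function.update_of_ne hbv, Function.update_of_ne hab.ne']
      · rw [fixAt_of_far hav haN]
    rw [key a b hab hav hbv, key b a hab.symm hbv hav]
    exact h.reciprocal a b hab
  · by_cases hav : a = v
    · subst hav; exact hpair b hab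
    by_cases hbv : b = v
    · subst hbv; exact (hpair a hab.symm).symm
    have hc := h.correct a b hab (fun hD => ha ⟨hD, hav⟩) (fun hD => hb ⟨hD, hbv⟩)
    by_cases haN : G.Adj v a
    · rw [hL'']
      exact (hf.2 a haN).2.2 b hab hbv hc
    by_cases hbN : G.Adj v b
    · rw [hL'']
      exact ((hf.2 b hbN).2.2 a hab.symm hav hc.symm).symm
    · exact hc.congr ((hL' a).trans (fixAt_of_far hav haN))
        ((hL' b).trans (fixAt_of_far hbv hbN))

/-- Stars whose centers have pairwise disjoint closed neighborhoods can be fixed concurrently. -/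
theorem concurrent_fix_valid (h : 𝓛.Valid G inp L D) {W : Set (Fin n)} {L' : Fin n → 𝓛.labels}
    (hW : ∀ u ∈ W, ∀ u' ∈ W, ∀ w, w = u ∨ G.Adj u w → w = u' ∨ G.Adj u' w → u = u')
    (hnear : ∀ u ∈ W, ∀ w, w = u ∨ G.Adj u w → (L' w).1 = 𝓛.fixAt G inp L u w)
    (hfar : ∀ w, (∀ u ∈ W, ¬ (w = u ∨ G.Adj u w)) → L' w = L w) :
    𝓛.Valid G inp L' (D \ W) := by
  classical
  -- The stars are fixed one after another. By disjointness, the earlier fixes have not touched what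
  -- the next one reads, so each fix gives the same result as on the original labels.
  have main : ∀ S : Finset (Fin n), (S : Set (Fin n)) ⊆ W → ∃ L₁ : Fin n → 𝓛.labels,
      𝓛.Valid G inp L₁ (D \ S) ∧
      (∀ u ∈ S, ∀ w, w = u ∨ G.Adj u w → (L₁ w).1 = 𝓛.fixAt G inp L u w) ∧
      ∀ w, (∀ u ∈ S, ¬ (w = u ∨ G.Adj u w)) → L₁ w = L w := by
    intro S
    induction S using Finset.induction_on with
    | empty => exact fun _ => ⟨L, by simpa using h, by simp, fun _ _ => rfl⟩
    | insert v S hvS ih =>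
      intro hS
      rw [Finset.coe_insert, Set.insert_subset_iff] at hS
      obtain ⟨L₁, hval, hn, hf⟩ := ih hS.2
      have hdisj : ∀ u ∈ S, ∀ w, w = u ∨ G.Adj u w → ¬ (w = v ∨ G.Adj v w) := by
        intro u hu w h1 h2
        have := hW u (hS.2 hu) v hS.1 w h1 h2
        exact hvS (this ▸ hu)
      refine ⟨fun w => ⟨𝓛.fixAt G inp L₁ v w, 𝓛.prepared_mem _ _ _ _ (fixAt_prepared hval v w)⟩,
        ?_, ?_, ?_⟩
      · have := fixAt_valid hval (v := v) (L' := fun w => ⟨𝓛.fixAt G inp L₁ v w,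
          𝓛.prepared_mem _ _ _ _ (fixAt_prepared hval v w)⟩) (fun _ => rfl)
        rwa [Set.sdiff_sdiff, Set.union_singleton, ← Finset.coe_insert] at this
      · intro u hu w hw
        rcases Finset.mem_insert.1 hu with rfl | hu
        · exact fixAt_congr (fun x hx => hf x fun y hy hxy => hdisj y hy x hxy hx) hw
        · have := hdisj u hu w hw
          rw [not_or] at this
          exact (fixAt_of_far this.1 this.2).trans (hn u hu w hw)
      · intro w hw
        have h1 := hw v (Finset.mem_insert_self _ _)
        rw [not_or] at h1
        apply Subtype.ext
        refine (fixAt_of_far h1.1 h1.2).trans (congrArg _ ?_)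
        exact hf w fun u hu => hw u (Finset.mem_insert_of_mem hu)
  obtain ⟨L₁, hval, hn, hf⟩ := main W.toFinite.toFinset (by simp)
  simp only [Set.Finite.coe_toFinset, Set.Finite.mem_toFinset] at hval hn hf
  have : L' = L₁ := by
    funext w
    by_cases hw : ∃ u ∈ W, w = u ∨ G.Adj u w
    · obtain ⟨u, hu, hw⟩ := hw
      exact Subtype.ext ((hnear u hu w hw).trans (hn u hu w hw).symm)
    · push Not at hw
      rw [hfar w fun u hu => by simpa using hw u hu, hf w fun u hu => by simpa using hw u hu]
  rwa [this]

/-! ### Adapting the labels to a new graph. -/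

open Classical in
/-- The label of a node that prepares itself only if its neighborhood has changed. -/
noncomputable def prepare (𝓛 : LFL n In X) (v : Fin n) (Nold Nnew : Set (Fin n)) (s : In)
    (l : 𝓛.labels) : 𝓛.labels :=
  if Nnew = Nold then l else 𝓛.prep v Nold Nnew s l

theorem prepare_self (v : Fin n) (N : Set (Fin n)) (s : In) (l : 𝓛.labels) :
    𝓛.prepare v N N s l = l := if_pos rfl

/-- Both endpoints of a new edge have changed neighborhoods, so both apply `prep`, and its
reciprocity clause covers the edge; on old edges the edge excerpts persist. A node with unchanged
neighborhood keeps its entire label, including the node excerpt, so correct edges between such nodes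
stay correct. -/
theorem prepare_valid (h : 𝓛.Valid G inp L D) (G' : SimpleGraph (Fin n)) :
    𝓛.Valid G' inp
      (fun v => 𝓛.prepare v (G.neighborSet v) (G'.neighborSet v) (inp v) (L v))
      (D ∪ {v | G'.neighborSet v ≠ G.neighborSet v}) := by
  have key : ∀ a b, a ≠ b → (G.Adj a b ↔ G'.Adj a b) →
      (𝓛.prepare a (G.neighborSet a) (G'.neighborSet a) (inp a) (L a)).1 b = (L a).1 b := by
    intro a b hab hG
    unfold prepare
    split_ifs
    · rfl
    · refine 𝓛.prep_isPreparing.unchanged a _ _ _ _ (by simp) (by simp) (h.prepared a) b hab.symm ?_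
      simp [Set.mem_symmDiff, hG]
  refine ⟨fun v => ?_, fun a b hab => ?_, fun a b hab ha hb => ?_⟩
  · unfold prepare
    split_ifs with hN
    · rw [hN]; exact h.prepared v
    · exact 𝓛.prep_isPreparing.prepared v _ _ _ _ (by simp) (by simp) (h.prepared v)
  · by_cases hG : G.Adj a b
    · rw [key a b hab.ne (by simp [hG, hab]), key b a hab.ne' (by simp [hG.symm, hab.symm])]
      exact h.reciprocal a b hG
    · have ha : G'.neighborSet a ≠ G.neighborSet a := fun e => hG (e ▸ hab : b ∈ G.neighborSet a)
      have hb : G'.neighborSet b ≠ G.neighborSet b := fun e =>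
        hG (e ▸ hab.symm : a ∈ G.neighborSet b).symm
      unfold prepare
      rw [if_neg ha, if_neg hb]
      exact 𝓛.prep_isPreparing.reciprocal a b _ _ _ _ _ _ _ _ (by simp) (by simp) (by simp)
        (by simp) (h.prepared a) (h.prepared b) hG (fun h' => hG h'.symm) hab hab.symm
  · simp only [Set.mem_union, Set.mem_ofPred_eq, not_or, not_not] at ha hb
    have hG : G.Adj a b := (ha.2 ▸ hab : b ∈ G.neighborSet a)
    exact (h.correct a b hG ha.1 hb.1).congr (by simp only [ha.2, prepare_self])
      (by simp only [hb.2, prepare_self])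

end LFL

/-! ### Rotating priorities and the algorithm. -/

/-- The priority of the node `w` in epoch `e`; small values come first. It rotates with `e`. -/
def rotatedRank {n : ℕ} (e : ℕ) (w : Fin n) : ℕ := (w + (n - e % n)) % n

/-- Without ties, all nodes that see the globally first dirty node name the same one. -/
theorem rotatedRank_injective {n : ℕ} (e : ℕ) : Function.Injective (rotatedRank (n := n) e) := by
  intro a b h
  have h' : (a : ℕ) + (n - e % n) ≡ b + (n - e % n) [MOD n] := h
  have := Nat.ModEq.add_right_cancel' _ h'
  exact Fin.ext (Nat.ModEq.eq_of_lt_of_lt this a.2 b.2)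

theorem rotatedRank_eq_zero {n : ℕ} {e : ℕ} {w : Fin n} (h : e % n = w) : rotatedRank e w = 0 := by
  have := w.2
  unfold rotatedRank
  rw [h, Nat.add_sub_cancel' this.le, Nat.mod_self]

/-- The messages of the fixing algorithm. -/
structure Message (n : ℕ) (In X : Type) where
  /-- The id of a node that asks for permission to fix its star, or receives it. -/
  key : Option (Fin n)
  /-- The input label of the sender. -/
  input : In
  /-- The node excerpt of the sender. -/
  excerpt : X
  /-- The new edge excerpt and the new node excerpt of the receiver, if the star of the sender is
  fixed in this round. -/
  update : Option (X × X)

namespace LFL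

variable {n : ℕ} {In X : Type} (𝓛 : LFL n In X)

/-- The state of a node in the fixing algorithm. -/
structure NodeState where
  id : Fin n
  clock : ℕ
  nbrs : Set (Fin n)
  input : In
  label : 𝓛.labels
  dirty : Prop
  /-- The first dirty node in the closed neighborhood. -/
  least : Option (Fin n)
  /-- The output of the fixing function, if the star of the node is about to be fixed. -/
  pending : Option (𝓛.labels × (Fin n → X))

namespace NodeState

variable {𝓛} (s : 𝓛.NodeState) (N : Set (Fin n)) (inbox : Fin n → Option (Message n In X))

open Classical in
/-- The message to the neighbor `u`. -/
noncomputable def message (u : Fin n) : Message n In X where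
  key := if s.clock % 3 = 0 then (if s.dirty ∨ N ≠ s.nbrs then some s.id else none) else s.least
  input := s.input
  excerpt := (𝓛.prepare s.id s.nbrs N s.input s.label).1 s.id
  update := if N = s.nbrs then s.pending.map fun p => (p.1.1 u, p.2 u) else none

/-- The label `l` implements the update that is received from `u`. -/
def IsReceived (l : 𝓛.labels) (u : Fin n) : Prop :=
  ∃ m x, inbox u = some m ∧ m.update = some x ∧
    l.1 = Function.update (Function.update s.label.1 s.id x.2) u x.1

open Classical in
/-- The label after the updates of the current round, before it is prepared for the
current neighborhood. -/
noncomputable def updatedLabel : 𝓛.labels :=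
  if N = s.nbrs ∧ s.pending.isSome then (s.pending.map Prod.fst).getD s.label
  else if h : ∃ l u, s.IsReceived inbox l u then h.choose else s.label

/-- The label at the end of the current round. -/
noncomputable def nextLabel : 𝓛.labels :=
  𝓛.prepare s.id s.nbrs N s.input (s.updatedLabel N inbox)

/-- The nodes in the closed neighborhood that are known to be dirty. -/
def candidates : Set (Fin n) :=
  {w | (w = s.id ∧ (s.dirty ∨ N ≠ s.nbrs)) ∨ ∃ u m, inbox u = some m ∧ m.key = some w}

open Classical in
/-- The first candidate. -/
noncomputable def nextLeast : Option (Fin n) :=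
  if h : (s.candidates N inbox).Nonempty ∧ s.clock % 3 = 0 then
    some (Function.argminOn (rotatedRank (s.clock / 3)) _ h.1)
  else none

open Classical in
/-- The output of the fixing function, if the node has permission to fix its star. -/
noncomputable def nextPending : Option (𝓛.labels × (Fin n → X)) :=
  if s.clock % 3 = 1 ∧ s.least = some s.id ∧
      ∀ u ∈ N, ∃ m, inbox u = some m ∧ m.key = some s.id then
    let out := 𝓛.fix s.id N s.input (fun u => ((inbox u).map Message.input).getD s.input)
      (s.nextLabel N inbox)
      (fun u => ((inbox u).map Message.excerpt).getD (s.label.1 s.id))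
    some (out.1, fun u => if h : u ∈ N then out.2 ⟨u, h⟩ else s.label.1 s.id)
  else none

/-- The state after the current round. -/
noncomputable def step : 𝓛.NodeState where
  id := s.id
  clock := s.clock + 1
  nbrs := N
  input := s.input
  label := s.nextLabel N inbox
  dirty := (s.dirty ∧ s.pending = none) ∨ N ≠ s.nbrs
  least := s.nextLeast N inbox
  pending := s.nextPending N inbox

end NodeState

/-- The fixing algorithm, with messages encoded by `enc`. -/
noncomputable def fixingAlgorithm (enc : Message n In X → List Bool) :
    DynAlgorithm n In 𝓛.labels where
  State := 𝓛.NodeState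
  init v N s L := ⟨v, 0, N, s, L, False, none, none⟩
  send s N u := enc (s.message N u)
  step s N inbox := s.step N fun u => (inbox u).bind (Function.partialInv enc)
  output := NodeState.label
  output_init _ _ _ _ := rfl

open Classical in
/-- The messages that `v` receives in the graph `G`. -/
noncomputable def inbox (G : SimpleGraph (Fin n)) (σ : Fin n → 𝓛.NodeState) (v u : Fin n) :
    Option (Message n In X) :=
  if G.Adj v u then some ((σ u).message (G.neighborSet u) v) else none

/-- `σ` is the sequence of states of all nodes in an execution. -/
structure IsExecution (G : ℕ → SimpleGraph (Fin n)) (inp : Fin n → In) (L₀ : Fin n → 𝓛.labels)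
    (σ : ℕ → Fin n → 𝓛.NodeState) : Prop where
  zero : ∀ v, σ 0 v = ⟨v, 0, (G 0).neighborSet v, inp v, L₀ v, False, none, none⟩
  succ : ∀ i v, σ (i + 1) v =
    (σ i v).step ((G i).neighborSet v) (𝓛.inbox (G i) (σ i) v)

/-- Decoding inverts encoding, so the execution can be analyzed with unencoded messages. Injectivity
is required only if there are two distinct nodes: for `n ≤ 1` the bandwidth is zero, but nothing is
ever sent. -/
theorem fixingAlgorithm_isExecution {enc : Message n In X → List Bool}
    (henc : ∀ v u : Fin n, v ≠ u → Function.Injective enc) (G : ℕ → SimpleGraph (Fin n))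
    (inp : Fin n → In) (L₀ : Fin n → 𝓛.labels) :
    𝓛.IsExecution G inp L₀ ((𝓛.fixingAlgorithm enc).state G inp L₀) where
  zero _ := rfl
  succ i v := by
    change NodeState.step _ _ _ = _
    congr 1
    funext u
    by_cases h : (G i).Adj v u
    · simp only [inbox, if_pos h, Option.bind_some]
      exact Function.partialInv_left (henc v u h.ne) _
    · simp only [inbox, if_neg h, Option.bind_none]

end LFL

/-! ### Invariants of executions. -/

namespace LFL

variable {n : ℕ} {In X : Type} {𝓛 : LFL n In X}

theorem inbox_eq_some {G : SimpleGraph (Fin n)} {σ : Fin n → 𝓛.NodeState} {v u : Fin n}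
    {m : Message n In X} :
    𝓛.inbox G σ v u = some m ↔ G.Adj v u ∧ (σ u).message (G.neighborSet u) v = m := by
  unfold inbox
  split_ifs with h <;> simp [h]

theorem inbox_of_adj {G : SimpleGraph (Fin n)} {σ : Fin n → 𝓛.NodeState} {v u : Fin n}
    (h : G.Adj v u) : 𝓛.inbox G σ v u = some ((σ u).message (G.neighborSet u) v) :=
  if_pos h

namespace IsExecution

variable {G : ℕ → SimpleGraph (Fin n)} {inp : Fin n → In} {L₀ : Fin n → 𝓛.labels}
  {σ : ℕ → Fin n → 𝓛.NodeState} (h : 𝓛.IsExecution G inp L₀ σ)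

include h

theorem id_eq (i : ℕ) (v : Fin n) : (σ i v).id = v := by
  induction i with
  | zero => rw [h.zero]
  | succ i ih => rw [h.succ]; exact ih

theorem clock_eq (i : ℕ) (v : Fin n) : (σ i v).clock = i := by
  induction i with
  | zero => rw [h.zero]
  | succ i ih => rw [h.succ]; exact congrArg (· + 1) ih

theorem input_eq (i : ℕ) (v : Fin n) : (σ i v).input = inp v := by
  induction i with
  | zero => rw [h.zero]
  | succ i ih => rw [h.succ]; exact ih

theorem nbrs_eq (i : ℕ) (v : Fin n) : (σ i v).nbrs = (G (i - 1)).neighborSet v := by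
  cases i with
  | zero => rw [h.zero]
  | succ i => rw [h.succ]; rfl

theorem pending_eq_none {i : ℕ} (hi : i % 3 ≠ 2) (v : Fin n) : (σ i v).pending = none := by
  cases i with
  | zero => rw [h.zero]
  | succ i =>
    rw [h.succ]
    refine if_neg fun hc => ?_
    rw [h.clock_eq] at hc
    omega

theorem dirty_succ (i : ℕ) (v : Fin n) : (σ (i + 1) v).dirty ↔
    ((σ i v).dirty ∧ (σ i v).pending = none) ∨
      (G i).neighborSet v ≠ (G (i - 1)).neighborSet v := by
  rw [h.succ, ← h.nbrs_eq]
  rfl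

theorem label_succ (i : ℕ) (v : Fin n) : (σ (i + 1) v).label =
    𝓛.prepare v ((G (i - 1)).neighborSet v) ((G i).neighborSet v) (inp v)
      ((σ i v).updatedLabel ((G i).neighborSet v) (𝓛.inbox (G i) (σ i) v)) := by
  rw [h.succ]
  change NodeState.nextLabel _ _ _ = _
  rw [NodeState.nextLabel, h.id_eq, h.nbrs_eq, h.input_eq]

theorem isReceived_iff {i : ℕ} {v : Fin n} {l : 𝓛.labels} {u : Fin n} :
    (σ i v).IsReceived (𝓛.inbox (G i) (σ i) v) l u ↔
      (G i).Adj v u ∧ (G i).neighborSet u = (G (i - 1)).neighborSet u ∧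
        ∃ p, (σ i u).pending = some p ∧
          l.1 = Function.update (Function.update (σ i v).label.1 v (p.2 v)) u (p.1.1 v) := by
  unfold NodeState.IsReceived
  simp only [inbox_eq_some, h.id_eq]
  constructor
  · rintro ⟨m, x, ⟨hadj, rfl⟩, hm, hl⟩
    simp only [NodeState.message, h.nbrs_eq] at hm
    split_ifs at hm with hN
    obtain ⟨p, hp, rfl⟩ := Option.map_eq_some_iff.1 hm
    exact ⟨hadj, hN, p, hp, hl⟩
  · rintro ⟨hadj, hN, p, hp, hl⟩
    refine ⟨_, (p.1.1 v, p.2 v), ⟨hadj, rfl⟩, ?_, hl⟩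
    simp only [NodeState.message, h.nbrs_eq, if_pos hN, hp, Option.map_some]

theorem label_succ_of_ne {i : ℕ} (hi : i % 3 ≠ 2) (v : Fin n) : (σ (i + 1) v).label =
    𝓛.prepare v ((G (i - 1)).neighborSet v) ((G i).neighborSet v) (inp v) (σ i v).label := by
  rw [h.label_succ]
  congr 1
  unfold NodeState.updatedLabel
  rw [if_neg (by simp [h.pending_eq_none hi]), dif_neg]
  rintro ⟨l, u, hl⟩
  obtain ⟨-, -, p, hp, -⟩ := h.isReceived_iff.1 hl
  simp [h.pending_eq_none hi] at hp

/-- The conditions under which the star of `v` is about to be fixed. -/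
theorem pending_spec {j : ℕ} {v : Fin n} {p : 𝓛.labels × (Fin n → X)}
    (hp : (σ (j + 1) v).pending = some p) :
    (∀ w, w = v ∨ (G j).Adj v w → (σ j w).least = some v) ∧
      p.1 = (𝓛.fixOutput (G j) inp (fun w => (σ (j + 1) w).label) v).1 ∧
      ∀ u (hu : (G j).Adj v u),
        p.2 u = (𝓛.fixOutput (G j) inp (fun w => (σ (j + 1) w).label) v).2 ⟨u, hu⟩ := by
  have hlab : (σ j v).nextLabel ((G j).neighborSet v) (𝓛.inbox (G j) (σ j) v) =
      (σ (j + 1) v).label := by rw [h.succ]; rfl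
  rw [h.succ] at hp
  change NodeState.nextPending _ _ _ = _ at hp
  unfold NodeState.nextPending at hp
  split_ifs at hp with hc
  rw [hlab] at hp
  simp only [h.id_eq, h.clock_eq, h.input_eq, inbox_eq_some] at hp hc
  obtain ⟨hj, hv, hu⟩ := hc
  have hout : 𝓛.fix v ((G j).neighborSet v) (inp v)
      (fun u => ((𝓛.inbox (G j) (σ j) v u).map Message.input).getD (inp v))
      (σ (j + 1) v).label
      (fun u => ((𝓛.inbox (G j) (σ j) v u).map Message.excerpt).getD ((σ j v).label.1 v)) =
      𝓛.fixOutput (G j) inp (fun w => (σ (j + 1) w).label) v := by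
    unfold fixOutput
    congr 1
    · funext u
      rw [inbox_of_adj u.2]
      exact h.input_eq _ _
    · funext u
      -- No fix is applied in this round, so the prepared excerpt in the message is already the one
      -- that `u` stores at the end of the round.
      have hl := h.label_succ_of_ne (i := j) (by omega) u
      rw [inbox_of_adj u.2]
      simp only [hl, NodeState.message, Option.map_some, Option.getD_some, h.id_eq, h.nbrs_eq,
        h.input_eq]
  rw [hout] at hp
  obtain rfl := Option.some.inj hp
  refine ⟨?_, rfl, fun u hu => dif_pos hu⟩
  rintro w (rfl | hw)
  · exact hv
  · obtain ⟨m, ⟨-, rfl⟩, hm⟩ := hu w hw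
    simpa [NodeState.message, h.clock_eq, hj] using hm

/-- The pending fixes were computed for `G i` from the current labels, so they are analyzed in `G
i`, before anybody prepares for `G (i + 1)`. A center whose own edges have changed withdraws its
fix; otherwise it still reaches all its neighbors, even those with other changed edges. -/
theorem updatedLabel_valid {i : ℕ} {D : Set (Fin n)}
    (hval : 𝓛.Valid (G i) inp (fun v => (σ (i + 1) v).label) D) :
    𝓛.Valid (G i) inp (fun v => (σ (i + 1) v).updatedLabel ((G (i + 1)).neighborSet v)
      (𝓛.inbox (G (i + 1)) (σ (i + 1)) v))
      (D \ {v | (G (i + 1)).neighborSet v = (G i).neighborSet v ∧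
        (σ (i + 1) v).pending.isSome}) := by
  -- A node `w` in both closed neighborhoods has named both centers, but it names at most one.
  have hsep : ∀ u u' w, (σ (i + 1) u).pending.isSome → (σ (i + 1) u').pending.isSome →
      (w = u ∨ (G i).Adj u w) → (w = u' ∨ (G i).Adj u' w) → u = u' := by
    intro u u' w hu hu' hw hw'
    obtain ⟨p, hp⟩ := Option.isSome_iff_exists.1 hu
    obtain ⟨p', hp'⟩ := Option.isSome_iff_exists.1 hu'
    exact Option.some.inj (((h.pending_spec hp).1 w hw).symm.trans ((h.pending_spec hp').1 w hw'))
  have hrec : ∀ {w l u}, (σ (i + 1) w).IsReceived (𝓛.inbox (G (i + 1)) (σ (i + 1)) w) l u →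
      (G i).Adj u w ∧ (G (i + 1)).neighborSet u = (G i).neighborSet u ∧
        (σ (i + 1) u).pending.isSome ∧
        l.1 = 𝓛.fixAt (G i) inp (fun v => (σ (i + 1) v).label) u w := by
    intro w l u hl
    obtain ⟨hadj, hN, p, hp, hl⟩ := h.isReceived_iff.1 hl
    rw [Nat.add_sub_cancel] at hN
    have hadj' : (G i).Adj u w := (Set.ext_iff.1 hN w).1 hadj.symm
    refine ⟨hadj', hN, by simp [hp], ?_⟩
    obtain ⟨-, h1, h2⟩ := h.pending_spec hp
    rw [fixAt_of_adj hadj', hl, h1, h2 w hadj']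
  refine concurrent_fix_valid hval ?_ ?_ ?_
  · exact fun u hu u' hu' w => hsep u u' w hu.2 hu'.2
  · rintro u ⟨hN, hu⟩ w hw
    obtain ⟨p, hp⟩ := Option.isSome_iff_exists.1 hu
    obtain ⟨-, h1, h2⟩ := h.pending_spec hp
    unfold NodeState.updatedLabel
    rw [h.nbrs_eq, Nat.add_sub_cancel]
    rcases hw with rfl | hw
    · rw [if_pos ⟨hN, hu⟩, hp, fixAt_self, ← h1]
      rfl
    · have hadj : (G (i + 1)).Adj u w := (Set.ext_iff.1 hN w).2 hw
      rw [if_neg fun hc => hw.ne (hsep u w w hu hc.2 (Or.inr hw) (Or.inl rfl))]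
      have hex : ∃ l u, (σ (i + 1) w).IsReceived (𝓛.inbox (G (i + 1)) (σ (i + 1)) w) l u := by
        refine ⟨⟨_, 𝓛.prepared_mem _ _ _ _ (fixAt_prepared hval u w)⟩, u,
          h.isReceived_iff.2 ⟨hadj.symm, hN, p, hp, ?_⟩⟩
        dsimp only
        rw [fixAt_of_adj hw, h1, h2 w hw]
      rw [dif_pos hex]
      obtain ⟨u', hu'⟩ := hex.choose_spec
      obtain ⟨hadj', -, hpend, hl⟩ := hrec hu'
      -- The update picked by choice comes from some center `u'` with a pending fix adjacent to `w`;
      -- by separation it is `u`.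
      rw [hl, hsep u' u w hpend hu (Or.inr hadj') (Or.inr hw)]
  · intro w hw
    have hnot : ¬ ((G (i + 1)).neighborSet w = (G i).neighborSet w ∧
        (σ (i + 1) w).pending.isSome) := fun hc => hw w hc (Or.inl rfl)
    unfold NodeState.updatedLabel
    rw [h.nbrs_eq, Nat.add_sub_cancel, if_neg hnot, dif_neg]
    rintro ⟨l, u, hl⟩
    obtain ⟨hadj, hN, hpend, -⟩ := hrec hl
    exact hw u ⟨hN, hpend⟩ (Or.inr hadj)

/-- The labels at the beginning of a round are valid for the previous graph. -/
theorem valid (hL : 𝓛.Legal (G 0) inp fun v => (L₀ v).1) (i : ℕ) :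
    𝓛.Valid (G (i - 1)) inp (fun v => (σ i v).label) {v | (σ i v).dirty} := by
  induction i with
  | zero => simpa [h.zero] using LabelingScheme.Valid.of_legal hL
  | succ i ih =>
    rw [Nat.add_sub_cancel]
    by_cases hi : i % 3 = 2
    · obtain ⟨i, rfl⟩ : ∃ j, i = j + 1 := ⟨i - 1, by omega⟩
      rw [Nat.add_sub_cancel] at ih
      -- First the fixes, relative to the old graph, then the preparation for the new one.
      have := prepare_valid (h.updatedLabel_valid ih) (G (i + 1))
      simp only [h.label_succ, Nat.add_sub_cancel]
      convert this using 1
      ext v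
      simp only [h.dirty_succ, Nat.add_sub_cancel, Set.mem_union, Set.mem_sdiff,
        Set.mem_ofPred_eq, ← Option.not_isSome_iff_eq_none]
      tauto
    · have := prepare_valid ih (G i)
      simp only [h.label_succ_of_ne hi]
      convert this using 1
      ext v
      simp [h.dirty_succ, h.pending_eq_none hi]

/-! ### Progress within an epoch. -/

/-- The candidates seen by `w` in the first round of an epoch are dirty. -/
theorem candidates_subset {i : ℕ} (hi : i % 3 = 0) (w : Fin n) :
    (σ i w).candidates ((G i).neighborSet w) (𝓛.inbox (G i) (σ i) w) ⊆
      {v | (σ (i + 1) v).dirty} := by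
  rintro v (⟨rfl, hv⟩ | ⟨u, m, hm, hk⟩)
  · rw [h.nbrs_eq] at hv
    rw [Set.mem_ofPred_eq, h.id_eq, h.dirty_succ]
    simpa [h.pending_eq_none (i := i) (by omega)] using hv
  · obtain ⟨-, rfl⟩ := inbox_eq_some.1 hm
    simp only [NodeState.message, h.clock_eq, hi, if_true, h.id_eq] at hk
    split_ifs at hk with hd
    rw [h.nbrs_eq] at hd
    obtain rfl := Option.some.inj hk
    rw [Set.mem_ofPred_eq, h.dirty_succ]
    simpa [h.pending_eq_none (i := i) (by omega)] using hd

/-- All candidates are dirty, so a globally first dirty node that is visible to `w` wins at `w`. -/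
theorem least_succ {i : ℕ} (hi : i % 3 = 0) {v w : Fin n} (hw : w = v ∨ (G i).Adj v w)
    (hv : (σ (i + 1) v).dirty)
    (hmin : ∀ u, (σ (i + 1) u).dirty → rotatedRank (i / 3) v ≤ rotatedRank (i / 3) u) :
    (σ (i + 1) w).least = some v := by
  have hd := (h.dirty_succ i v).1 hv
  simp only [h.pending_eq_none (i := i) (by omega), and_true] at hd
  have hmem : v ∈ (σ i w).candidates ((G i).neighborSet w) (𝓛.inbox (G i) (σ i) w) := by
    rcases hw with rfl | hw
    · exact Or.inl ⟨(h.id_eq _ _).symm, by rwa [h.nbrs_eq]⟩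
    · refine Or.inr ⟨v, _, inbox_of_adj hw.symm, ?_⟩
      rw [← h.nbrs_eq] at hd
      simp only [NodeState.message, h.clock_eq, hi, if_true, h.id_eq, if_pos hd]
  rw [h.succ]
  change NodeState.nextLeast _ _ _ = _
  unfold NodeState.nextLeast
  rw [dif_pos ⟨Set.nonempty_of_mem hmem, by rwa [h.clock_eq]⟩]
  congr 1
  replace hmin : ∀ u, (σ (i + 1) u).dirty →
      rotatedRank ((σ i w).clock / 3) v ≤ rotatedRank ((σ i w).clock / 3) u := by
    rwa [h.clock_eq]
  apply rotatedRank_injective ((σ i w).clock / 3)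
  refine le_antisymm (Function.argminOn_le _ _ hmem) (hmin _ ?_)
  exact h.candidates_subset hi w (Function.argminOn_mem (rotatedRank ((σ i w).clock / 3)) _ _)

/-- The first dirty node fixes its star, unless its edges change during the epoch. -/
theorem not_dirty_of_min {i : ℕ} (hi : i % 3 = 0) {v : Fin n}
    (h1 : (G (i + 1)).neighborSet v = (G i).neighborSet v)
    (h2 : (G (i + 2)).neighborSet v = (G (i + 1)).neighborSet v)
    (hv : (σ (i + 1) v).dirty)
    (hmin : ∀ u, (σ (i + 1) u).dirty → rotatedRank (i / 3) v ≤ rotatedRank (i / 3) u) :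
    ¬ (σ (i + 3) v).dirty := by
  have hpend : (σ (i + 2) v).pending ≠ none := by
    rw [h.succ]
    change NodeState.nextPending _ _ _ ≠ _
    unfold NodeState.nextPending
    rw [if_pos]
    · simp
    rw [h.clock_eq, h.id_eq]
    refine ⟨by omega, h.least_succ hi (Or.inl rfl) hv hmin, fun u hu => ?_⟩
    refine ⟨_, inbox_of_adj hu, ?_⟩
    -- Neighbors in the second round were already neighbors in the first, so they have heard the
    -- announcement of `v`.
    rw [h1] at hu
    have hi' : ¬ (i + 1) % 3 = 0 := by omega
    simp only [NodeState.message, h.clock_eq, if_neg hi']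
    exact h.least_succ hi (Or.inr hu) hv hmin
  rw [h.dirty_succ]
  simp [hpend, h2]

theorem not_dirty_of_unchanged {i : ℕ} {v : Fin n} (hv : ¬ (σ i v).dirty)
    (hG : (G i).neighborSet v = (G (i - 1)).neighborSet v) : ¬ (σ (i + 1) v).dirty := by
  rw [h.dirty_succ]
  simp [hv, hG]

end IsExecution

end LFL

/-! ### Counting changed nodes and amortizing over epochs. -/

theorem ncard_changed_le {n : ℕ} (G G' : SimpleGraph (Fin n)) :
    {v | G'.neighborSet v ≠ G.neighborSet v}.ncard ≤ 2 * (G.edgeSet ∆ G'.edgeSet).ncard := by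
  classical
  have hsub : {v | G'.neighborSet v ≠ G.neighborSet v} ⊆
      ((G.edgeSet ∆ G'.edgeSet).toFinset.biUnion Sym2.toFinset : Finset (Fin n)) := by
    intro v hv
    obtain ⟨w, hw⟩ : ∃ w, ¬ (w ∈ G'.neighborSet v ↔ w ∈ G.neighborSet v) := by
      by_contra! hc
      exact hv (Set.ext hc)
    simp only [Finset.coe_biUnion, Set.mem_iUnion]
    refine ⟨s(v, w), ?_, by simp⟩
    simp only [SimpleGraph.mem_neighborSet] at hw
    simp only [Set.coe_toFinset, Set.mem_symmDiff, SimpleGraph.mem_edgeSet]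
    tauto
  refine (Set.ncard_le_ncard hsub (Finset.finite_toSet _)).trans ?_
  rw [Set.ncard_coe_finset, Set.ncard_eq_toFinset_card', mul_comm]
  refine Finset.card_biUnion_le_card_mul _ _ _ fun e _ => ?_
  induction e with
  | h a b =>
    rw [Sym2.toFinset_mk_eq]
    exact Finset.card_le_two

/-- Amortization over epochs of three rounds. -/
theorem ncard_bad_le {bad : ℕ → Prop} {d δ : ℕ → ℕ} (h0 : d 0 = 0)
    (hbad : ∀ j, bad j → 0 < d j ∨ 0 < δ j) (hstep : ∀ j, d (j + 1) ≤ d j + 2 * δ j)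
    (hprog : ∀ j, j % 3 = 0 → 0 < d j → δ j = 0 → δ (j + 1) = 0 → δ (j + 2) = 0 →
      d (j + 3) < d j) (i : ℕ) :
    {j | j ≤ i ∧ bad j}.ncard ≤ 9 * ∑ j ∈ Finset.range (i + 1), δ j := by
  classical
  have hcard : {j | j ≤ i ∧ bad j}.ncard =
      ∑ j ∈ Finset.range (i + 1), if bad j then 1 else 0 := by
    rw [← Finset.card_filter, ← Set.ncard_coe_finset]
    congr 1
    ext j
    simp
  obtain ⟨b, hbdef⟩ : ∃ b : ℕ → ℕ, b = fun j => if bad j then 1 else 0 := ⟨_, rfl⟩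
  have hb : ∀ j, b j ≤ 1 ∧ b j ≤ d j + δ j := by
    intro j
    simp only [hbdef]
    split_ifs with hj
    · have := hbad j hj
      omega
    · omega
  rw [hcard, ← hbdef]
  -- The potential is `3 * d`. An epoch without changes has at most three bad rounds, paid by the
  -- loss of a dirty node, and none if `d = 0`. Otherwise, each change pays 3 for the bad rounds and
  -- 6 for the two nodes that it may make dirty, which gives the constant 9.
  have hepoch : ∀ e, ∑ j ∈ Finset.range (3 * e), b j + 3 * d (3 * e) ≤
      9 * ∑ j ∈ Finset.range (3 * e), δ j := by
    intro e
    induction e with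
    | zero => simp [h0]
    | succ e ih =>
      have := hprog (3 * e) (by omega)
      have := hstep (3 * e)
      have := hstep (3 * e + 1)
      have := hstep (3 * e + 2)
      have := hb (3 * e)
      have := hb (3 * e + 1)
      have := hb (3 * e + 2)
      simp only [Nat.mul_succ, Finset.sum_range_succ]
      simp only [add_assoc, Nat.reduceAdd] at *
      omega
  obtain ⟨e, he⟩ : ∃ e, i + 1 = 3 * e ∨ i + 1 = 3 * e + 1 ∨ i + 1 = 3 * e + 1 + 1 :=
    ⟨(i + 1) / 3, by omega⟩
  have := hepoch e
  have := hstep (3 * e)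
  have := hb (3 * e)
  have := hb (3 * e + 1)
  -- The at most two rounds of an unfinished epoch are paid by the remaining potential and by their
  -- own changes.
  rcases he with he | he | he <;> simp only [he, Finset.sum_range_succ] <;> omega

/-! ### The size of messages. -/

theorem EncodableInBits.finite_card_le {α : Type} {b : ℕ} (h : EncodableInBits α b) :
    Finite α ∧ Nat.card α ≤ 2 ^ (2 * b) := by
  obtain ⟨enc, hinj, hlen⟩ := h
  -- A string of length at most `b` is a word of `b` letters from `Option Bool`, with `none` past
  -- its end; this gives `3 ^ b ≤ 2 ^ (2 * b)` possibilities.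
  have hf : Function.Injective fun a => fun i : Fin b => (enc a)[(i : ℕ)]? := by
    intro a a' haa
    refine hinj (List.ext_getElem? fun i => ?_)
    by_cases hi : i < b
    · exact congrFun haa ⟨i, hi⟩
    · rw [List.getElem?_eq_none (by have := hlen a; omega),
        List.getElem?_eq_none (by have := hlen a'; omega)]
  refine ⟨Finite.of_injective _ hf, (Nat.card_le_card_of_injective _ hf).trans ?_⟩
  rw [Nat.card_eq_fintype_card, Fintype.card_fun, Fintype.card_option, Fintype.card_bool,
    Fintype.card_fin, pow_mul]
  exact Nat.pow_le_pow_left (by norm_num) b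

theorem EncodableInBits.of_card_le {α : Type} [Finite α] {b : ℕ} (h : Nat.card α ≤ 2 ^ b) :
    EncodableInBits α b := by
  have := Fintype.ofFinite α
  obtain ⟨f⟩ : Nonempty (α ↪ (Fin b → Bool)) := by
    apply Function.Embedding.nonempty_of_card_le
    simpa [Nat.card_eq_fintype_card] using h
  exact ⟨fun a => List.ofFn (f a), List.ofFn_injective.comp f.injective, by simp⟩

/-- One input and three excerpts cost `2 * c` each, in units of `Nat.clog 2 n`; the optional id
costs 2 and the option around the update costs 1. -/
theorem Message.encodableInBits {n c : ℕ} {In X : Type} (hn : 2 ≤ n)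
    (hIn : EncodableInBits In (c * Nat.clog 2 n)) (hX : EncodableInBits X (c * Nat.clog 2 n)) :
    EncodableInBits (Message n In X) ((8 * c + 3) * Nat.clog 2 n) := by
  obtain ⟨_, hIn⟩ := hIn.finite_card_le
  obtain ⟨_, hX⟩ := hX.finite_card_le
  have hf : Function.Injective fun m : Message n In X => (m.key, m.input, m.excerpt, m.update) := by
    rintro ⟨⟩ ⟨⟩ h
    simpa using h
  have := Finite.of_injective _ hf
  refine .of_card_le ((Nat.card_le_card_of_injective _ hf).trans ?_)
  simp only [Nat.card_prod, Finite.card_option, Nat.card_fin]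
  have hL : 1 ≤ Nat.clog 2 n := Nat.clog_pos (by norm_num) hn
  have hn' : n ≤ 2 ^ Nat.clog 2 n := Nat.le_pow_clog (by norm_num) n
  generalize Nat.clog 2 n = l at *
  have h2 : 2 ≤ 2 ^ l := by simpa using Nat.pow_le_pow_right (n := 2) (by norm_num) hL
  have hone : ∀ x, 1 ≤ x → x + 1 ≤ x * 2 ^ l := fun x hx => by nlinarith
  calc (n + 1) * (Nat.card In * (Nat.card X * (Nat.card X * Nat.card X + 1)))
      ≤ (2 ^ l + 1) * (2 ^ (2 * (c * l)) * (2 ^ (2 * (c * l)) *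
          (2 ^ (2 * (c * l)) * 2 ^ (2 * (c * l)) + 1))) := by gcongr
    _ ≤ (2 ^ l * 2 ^ l) * (2 ^ (2 * (c * l)) * (2 ^ (2 * (c * l)) *
          (2 ^ (2 * (c * l)) * 2 ^ (2 * (c * l)) * 2 ^ l))) := by
        gcongr
        · exact hone _ Nat.one_le_two_pow
        · exact hone _ (Nat.mul_pos (by positivity) (by positivity))
    _ = 2 ^ ((8 * c + 3) * l) := by
        simp only [← pow_add]
        congr 1
        ring

/-! ### The fixing property and the amortized bound. -/

namespace LFL

variable {n : ℕ} {In X : Type} {𝓛 : LFL n In X}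

namespace IsExecution

variable {G : ℕ → SimpleGraph (Fin n)} {inp : Fin n → In} {L₀ : Fin n → 𝓛.labels}
  {σ : ℕ → Fin n → 𝓛.NodeState} (h : 𝓛.IsExecution G inp L₀ σ)

include h

theorem eventually_starConsistent (hL : 𝓛.Legal (G 0) inp fun v => (L₀ v).1) (v : Fin n) (i : ℕ) :
    ∃ j ≥ i, 𝓛.StarConsistent (G j) inp (fun w => (σ j w).label.1) v ∨ Touched G v j := by
  by_contra! hc
  have hN : ∀ j ≥ i, ∀ w, (w = v ∨ (G j).Adj v w) →
      (G (j + 1)).neighborSet w = (G j).neighborSet w := by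
    intro j hj w hw
    by_contra hne
    exact (hc j hj).2 ⟨w, hw, Ne.symm hne⟩
  have hadj : ∀ j ≥ i, ∀ w, (G j).Adj v w ↔ (G i).Adj v w := by
    intro j hj w
    induction j, hj using Nat.le_induction with
    | base => rfl
    | succ j hj ih => exact (Set.ext_iff.1 (hN j hj v (Or.inl rfl)) w).trans ih
  have hN' : ∀ j ≥ i, ∀ w, (w = v ∨ (G i).Adj v w) →
      (G (j + 1)).neighborSet w = (G j).neighborSet w :=
    fun j hj w hw => hN j hj w (hw.imp id (hadj j hj w).2)
  -- Near `v` no edges change from now on, so a clean node remains clean; the nodes may therefore be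
  -- cleaned in different epochs.
  have hstay : ∀ w, (w = v ∨ (G i).Adj v w) → ∀ j ≥ i + 1, ¬ (σ j w).dirty →
      ∀ k ≥ j, ¬ (σ k w).dirty := by
    intro w hw j hj hd k hk
    induction k, hk using Nat.le_induction with
    | base => exact hd
    | succ k hk ih =>
      refine h.not_dirty_of_unchanged ih ?_
      have := hN' (k - 1) (by omega) w hw
      rwa [Nat.sub_add_cancel (by omega)] at this
  have hclean : ∀ w, (w = v ∨ (G i).Adj v w) →
      ¬ (σ (3 * (n * (i + 1) + n) + 3) w).dirty := by
    intro w hw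
    have hwn := w.2
    have hge : i + 1 ≤ n * (i + 1) := Nat.le_mul_of_pos_left _ (by omega)
    -- The epoch `n * (i + 1) + w` is congruent to `w` modulo `n` and begins after round `i`. There
    -- `w` has rank 0 and precedes all dirty nodes, wherever they are.
    refine hstay w hw (3 * (n * (i + 1) + w) + 3) (by omega) ?_ _ (by omega)
    by_cases hd : (σ (3 * (n * (i + 1) + w) + 1) w).dirty
    · refine h.not_dirty_of_min (by omega) (hN' _ (by omega) w hw) (hN' _ (by omega) w hw) hd ?_
      intro u _
      rw [rotatedRank_eq_zero (w := w)]
      · exact Nat.zero_le _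
      · rw [Nat.mul_div_cancel_left _ (by norm_num), Nat.mul_add_mod, Nat.mod_eq_of_lt hwn]
    · exact hstay w hw _ (by omega) hd _ (by omega)
  have hge : i + 1 ≤ n * (i + 1) := Nat.le_mul_of_pos_left _ (by have := v.2; omega)
  refine (hc (3 * (n * (i + 1) + n) + 3) (by omega)).1 ?_
  have hval := h.valid hL (3 * (n * (i + 1) + n) + 3)
  rw [Nat.add_sub_assoc (by norm_num)] at hval
  have hs := hval.starConsistent (hclean v (Or.inl rfl)) fun u hu =>
    hclean u (Or.inr ((hadj _ (by omega) u).1 hu))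
  unfold LabelingScheme.StarConsistent at hs ⊢
  -- Validity refers to the graph of the previous round, in which `v` has the same neighbors.
  rwa [hN' (3 * (n * (i + 1) + n) + 2) (by omega) v (Or.inl rfl)]

theorem dirty_eq_of_unchanged {i : ℕ} (hi : i % 3 ≠ 2) (hG : G (i - 1) = G i) (v : Fin n) :
    (σ (i + 1) v).dirty ↔ (σ i v).dirty := by
  rw [h.dirty_succ, hG, h.pending_eq_none hi]
  simp

theorem ncard_incorrect_le (hL : 𝓛.Legal (G 0) inp fun v => (L₀ v).1) (i : ℕ) :
    {j : ℕ | j ≤ i ∧ ¬ (𝓛.Legal (G j) inp (fun w => (σ j w).label.1) ∧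
      𝓛.Legal (G j) inp (fun w => (σ (j + 1) w).label.1))}.ncard ≤ 9 * changes G i := by
  -- Each change is charged to the round that it leads into; the term for `j = 0` vanishes since `0
  -- - 1 = 0`.
  have hchanges : changes G i =
      ∑ j ∈ Finset.range (i + 1), ((G (j - 1)).edgeSet ∆ (G j).edgeSet).ncard := by
    rw [Finset.sum_range_succ']
    simp [changes]
  have hδ : ∀ {j}, ((G (j - 1)).edgeSet ∆ (G j).edgeSet).ncard = 0 → G (j - 1) = G j := by
    intro j hj
    rw [Set.ncard_eq_zero] at hj
    exact SimpleGraph.edgeSet_injective (symmDiff_eq_bot.1 hj)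
  have hempty : ∀ {j}, {v | (σ j v).dirty}.ncard = 0 → {v | (σ j v).dirty} = ∅ :=
    fun hj => (Set.ncard_eq_zero).1 hj
  rw [hchanges]
  refine ncard_bad_le (d := fun j => {v | (σ j v).dirty}.ncard) ?_ ?_ ?_ ?_ i
  · simp [h.zero]
  · intro j hj
    by_contra! hc
    obtain ⟨hd, hG⟩ := hc
    have hd := hempty (Nat.le_zero.1 hd)
    have hG := hδ (Nat.le_zero.1 hG)
    have hd' : {v | (σ (j + 1) v).dirty} = ∅ := by
      refine Set.eq_empty_of_forall_notMem fun v => h.not_dirty_of_unchanged ?_ (by rw [hG])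
      exact (Set.ext_iff.1 hd v).1
    have h1 := h.valid hL j
    have h2 := h.valid hL (j + 1)
    rw [hd, hG] at h1
    rw [hd'] at h2
    exact hj ⟨h1.legal, h2.legal⟩
  · intro j
    refine le_trans (Set.ncard_le_ncard ?_) ((Set.ncard_union_le _ _).trans
      (Nat.add_le_add_left (ncard_changed_le (G (j - 1)) (G j)) _))
    intro v hv
    exact ((h.dirty_succ j v).1 hv).imp And.left id
  · intro j hj hd h0 h1 h2
    replace h0 := hδ h0
    replace h1 := hδ h1
    replace h2 := hδ h2
    change G j = G (j + 1) at h1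
    change G (j + 1) = G (j + 2) at h2
    have e1 := h.dirty_eq_of_unchanged (i := j) (by omega) h0
    have e2 := h.dirty_eq_of_unchanged (i := j + 1) (by omega) h1
    obtain ⟨v, hv, hmin⟩ := Set.exists_min_image {v | (σ j v).dirty} (rotatedRank (j / 3))
      (Set.toFinite _) (Set.nonempty_of_ncard_ne_zero hd.ne')
    have hclean := h.not_dirty_of_min (v := v) hj (by rw [h1]) (by rw [h2]) ((e1 v).2 hv)
      fun u hu => hmin u ((e1 u).1 hu)
    -- Without changes no node becomes dirty, and the first dirty node becomes clean, so the dirty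
    -- set shrinks strictly.
    refine Set.ncard_lt_ncard ⟨fun u hu => ?_, fun hc => hclean (hc hv)⟩ (Set.toFinite _)
    by_contra hu'
    refine h.not_dirty_of_unchanged (i := j + 2) (v := u) ?_ (by rw [← h2]; rfl) hu
    rwa [e2, e1]

end IsExecution

end LFL

theorem mainTheorem2 :
    ∃ K : ℕ, ∀ c : ℕ, ∃ C : ℕ, ∀ (n : ℕ) (In X : Type) (𝓛 : LFL n In X), 𝓛.Bounded c →
      ∃ A : DynAlgorithm n In 𝓛.labels,
        A.HasBandwidth (C * Nat.clog 2 n) ∧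
        𝓛.IsFixingAlgorithm A ∧
        𝓛.HasAmortizedComplexity A K := by
  refine ⟨9, fun c => ⟨8 * c + 3, fun n In X 𝓛 hb => ?_⟩⟩
  obtain ⟨enc, hinj, hlen⟩ : ∃ enc : Message n In X → List Bool,
      (∀ v u : Fin n, v ≠ u → Function.Injective enc) ∧
      ∀ m, (enc m).length ≤ (8 * c + 3) * Nat.clog 2 n := by
    by_cases hn : 2 ≤ n
    · obtain ⟨enc, hinj, hlen⟩ := Message.encodableInBits hn hb.1 hb.2
      exact ⟨enc, fun _ _ _ => hinj, hlen⟩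
    · exact ⟨fun _ => [], fun v u hvu => absurd (Fin.ext (by omega)) hvu, by simp⟩
  refine ⟨𝓛.fixingAlgorithm enc, fun _ _ _ => hlen _, fun G inp L₀ hL v i => ?_,
    fun G inp L₀ hL i => ?_⟩
  · exact (𝓛.fixingAlgorithm_isExecution hinj G inp L₀).eventually_starConsistent hL v i
  · exact (𝓛.fixingAlgorithm_isExecution hinj G inp L₀).ncard_incorrect_le hL i
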